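/- For integers $r,s,d\ge 0$ let $P_{r,s}^{[d]}:=\sum_{i=1}^{r}\prod_{j=1}^{d}x_{ij}+\sum_{i=1}^{s}y_i^{d}$, a polynomial over $\mathbb{C}$ in the $rd+s$ variables $x_{ij},y_i$. For polynomials $f\in\mathbb{C}[U]$ and $g\in\mathbb{C}[W]$ on finite-dimensional complex vector spaces, write $f\trianglelefteq_{\mathrm{aff}}g$ if $f$ lies in the closure of $\{\,v\mapsto g(Av+b)\mid A\colon U\to W\text{ linear},\ b\in W\,\}$, taken in the Euclidean topology (coefficientwise convergence; these polynomials all have degree at most $\deg g$). **Theorem.** There is a constant $c>0$ such that for all integers $d\ge 2$ and $e\ge 0$: if $P_{1,2}^{[d]}\trianglelefteq_{\mathrm{aff}}P_{1,1}^{[e]}$, then $e\ge \exp(c\,d)$. This is optimal up to the constant in the exponent: there is a constant $K>0$ such that for every $d\ge 1$ there is an $e\le\exp(K d)$ with $P_{1,2}^{[d]}\trianglelefteq_{\mathrm{aff}}P_{1,1}^{[e]}$. -/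

import Mathlib

open MvPolynomial

noncomputable section

/-- The polynomial `P_{r,s}^{[d]} = ∑_{i ≤ r} ∏_{j ≤ d} x_{ij} + ∑_{i ≤ s} y_i ^ d` over `ℂ`, in the
`r * d + s` variables `x_{ij} = X (Sum.inl (i, j))` and `y_i = X (Sum.inr i)`. -/
def sumProdPow (r s d : ℕ) : MvPolynomial ((Fin r × Fin d) ⊕ Fin s) ℂ :=
  ∑ i : Fin r, ∏ j : Fin d, X (Sum.inl (i, j)) + ∑ i : Fin s, X (Sum.inr i) ^ d

/-- The polynomial `x ↦ g (A x + b)`, where `A : ℂ^σ → ℂ^τ` is linear and `b ∈ ℂ^τ`. -/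
def affineSubst {σ τ : Type*} [Fintype σ] (A : Matrix τ σ ℂ) (b : τ → ℂ)
    (g : MvPolynomial τ ℂ) : MvPolynomial σ ℂ :=
  aeval (fun j : τ => ∑ i : σ, C (A j i) * X i + C (b j)) g

/-- The set of all `g ∘ L` with `L : ℂ^σ → ℂ^τ` affine linear. -/
def affineProjections (σ : Type*) {τ : Type*} [Fintype σ] (g : MvPolynomial τ ℂ) :
    Set (MvPolynomial σ ℂ) :=
  {p | ∃ (A : Matrix τ σ ℂ) (b : τ → ℂ), p = affineSubst A b g}

/-- The vector of all coefficients of a polynomial. -/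
def coeffVec {σ : Type*} (p : MvPolynomial σ ℂ) : (σ →₀ ℕ) → ℂ := fun m => coeff m p

/-- `f` is an affine degeneration of `g`: it lies in the closure of the set of all `g ∘ L` with `L`
affine linear. All these polynomials have total degree at most that of `g`, so they lie in one
finite-dimensional space, on which the topology of coefficientwise convergence used here is the
Euclidean one; that space is closed, so the closure is the Euclidean closure inside it. -/
def AffDegeneration {σ τ : Type*} [Fintype σ] (f : MvPolynomial σ ℂ) (g : MvPolynomial τ ℂ) : Prop :=
  coeffVec f ∈ closure (coeffVec '' affineProjections σ g)

end

/-! Lower bound: after homogenising with a variable `z`, `z^(e-d) P` is a limit of `∏ ℓ_i + κ^e`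
with `ℓ_i`, `κ` linear. Along an ultrafilter `κ` is either bounded or unbounded. If bounded, the
limit is again a product plus a power (`exists_eq_prod_add_pow`), so `P` would be a constant plus a
power on some hyperplane, or everywhere; this fails for `d ≥ 3`. If unbounded, let `k` be the limit
direction of `κ` and restrict to lines in a direction `h` with `k ⬝ᵥ h ≠ 0`, based on the kernel of
`κ`. There the power affects only `t^e`, and the other coefficients are elementary symmetric
functions scaled by `a = ∏ ℓ_i(h)`, which tends to infinity. By Newton's identities the scaled power
sums converge too, so each such coefficient of the limit is a limit of sums of `e` powers of linear
forms. For a suitable `h` one of them is, on the test vectors, a product of `d - 1` variables, and a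
matrix of size `2^(d-1)` forces `e` to be exponential (`card_le_of_tendsto_prod_add_pow`). Upper
bound: polarisation writes `P` as a sum of `2^d + 2` powers `L_i^d`, which is the limit of `δ⁻¹ ∏ (1
+ δ L_i^d) - δ⁻¹`; each factor splits into `d` affine forms. -/

open Filter Topology

/-! ### Ultrafilter limits; values and coefficients of polynomials. -/

/-- A bounded family in a proper metric space converges along an ultrafilter. -/
theorem Ultrafilter.exists_tendsto_of_bounded {α E : Type*} [NormedAddCommGroup E] [ProperSpace E]
    (u : Ultrafilter α) (f : α → E) (R : ℝ) (h : ∀ᶠ x in (u : Filter α), ‖f x‖ ≤ R) :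
    ∃ a, Tendsto f u (𝓝 a) := by
  have hm : Metric.closedBall (0 : E) R ∈ u.map f := by
    rw [Ultrafilter.mem_map]
    filter_upwards [h] with x hx
    simpa using hx
  obtain ⟨a, -, ha⟩ := (isCompact_closedBall (0 : E) R).ultrafilter_le_nhds' _ hm
  exact ⟨a, ha⟩

theorem Ultrafilter.bounded_or_tendsto_atTop {α : Type*} (u : Ultrafilter α) (f : α → ℝ) :
    (∃ R, ∀ᶠ x in (u : Filter α), f x ≤ R) ∨ Tendsto f u atTop := by
  by_cases h : ∃ R, ∀ᶠ x in (u : Filter α), f x ≤ R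
  · exact Or.inl h
  · right
    rw [tendsto_atTop]
    intro b
    have := mt (fun h' => (⟨b, h'⟩ : ∃ R, ∀ᶠ x in (u : Filter α), f x ≤ R)) h
    rw [Ultrafilter.eventually_not.symm] at this
    filter_upwards [this] with x hx using (not_le.mp hx).le

/-- Pointwise convergence away from `0` of polynomials of bounded degree implies convergence of the
coefficients. -/
theorem Polynomial.tendsto_coeff_of_tendsto_eval {α : Type*} {l : Filter α} {q : α → Polynomial ℂ}
    {Q : Polynomial ℂ} {n : ℕ} (hq : ∀ x, (q x).natDegree ≤ n) (hQ : Q.natDegree ≤ n)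
    (h : ∀ t : ℂ, t ≠ 0 → Tendsto (fun x => (q x).eval t) l (𝓝 (Q.eval t))) (k : ℕ) :
    Tendsto (fun x => (q x).coeff k) l (𝓝 (Q.coeff k)) := by
  -- Lagrange interpolation at `1, …, n + 1`, nodes chosen to avoid `0`.
  have key : ∀ p : Polynomial ℂ, p.natDegree ≤ n → p.coeff k = ∑ i ∈ Finset.range (n + 1),
      p.eval ((i : ℂ) + 1) *
        (Lagrange.basis (Finset.range (n + 1)) (fun i : ℕ => (i : ℂ) + 1) i).coeff k := by
    intro p hp
    have hinj : Set.InjOn (fun i : ℕ => (i : ℂ) + 1) (Finset.range (n + 1)) := by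
      intro i _ j _ hij
      simpa using hij
    have hdeg : p.degree < (Finset.range (n + 1)).card := by
      rw [Finset.card_range]
      exact lt_of_le_of_lt (Polynomial.degree_le_of_natDegree_le hp)
        (by exact_mod_cast Nat.lt_succ_self n)
    have := Lagrange.eq_interpolate hinj hdeg
    conv_lhs => rw [this]
    simp [Lagrange.interpolate_apply, Polynomial.coeff_C_mul]
  rw [key Q hQ]
  simp_rw [fun x => key (q x) (hq x)]
  refine tendsto_finsetSum _ fun i _ => (h _ ?_).mul_const _
  exact_mod_cast Nat.succ_ne_zero i

theorem Polynomial.tendsto_eval_of_tendsto_coeff {α : Type*} {l : Filter α} {q : α → Polynomial ℂ}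
    {Q : Polynomial ℂ} {n : ℕ} (hq : ∀ x, (q x).natDegree ≤ n) (hQ : Q.natDegree ≤ n)
    (h : ∀ k, Tendsto (fun x => (q x).coeff k) l (𝓝 (Q.coeff k))) {t : α → ℂ} {s : ℂ}
    (ht : Tendsto t l (𝓝 s)) :
    Tendsto (fun x => (q x).eval (t x)) l (𝓝 (Q.eval s)) := by
  rw [Polynomial.eval_eq_sum_range' (Nat.lt_succ_of_le hQ)]
  simp_rw [fun x => Polynomial.eval_eq_sum_range' (Nat.lt_succ_of_le (hq x)) (t x)]
  exact tendsto_finsetSum _ fun i _ => (h i).mul (ht.pow i)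

/-! ### Newton's identities and a rank bound for limits of power sums. -/

/-- If the elementary symmetric functions of `m x`, scaled by `a x → ∞`, converge, then so do the
power sums. -/
theorem tendsto_mul_psum {α : Type*} {l : Filter α} {e : ℕ} {a : α → ℂ} {m : α → Fin e → ℂ}
    {F : ℕ → ℂ} (ha : Tendsto (fun x => ‖a x‖) l atTop)
    (h : ∀ k, 1 ≤ k → k ≤ e → Tendsto (fun x => a x * aeval (m x) (esymm (Fin e) ℂ k)) l (𝓝 (F k)))
    (k : ℕ) (hk : 1 ≤ k) (hke : k ≤ e) :
    Tendsto (fun x => a x * ∑ i, m x i ^ k) l (𝓝 ((-1) ^ (k + 1) * k * F k)) := by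
  have ha0 : Tendsto (fun x => (a x)⁻¹) l (𝓝 0) := by
    rw [tendsto_zero_iff_norm_tendsto_zero]
    simpa [Function.comp_def] using tendsto_inv_atTop_zero.comp ha
  have hne : ∀ᶠ x in l, a x ≠ 0 := by
    filter_upwards [ha.eventually_gt_atTop 0] with x hx
    exact norm_pos_iff.mp hx
  have he : ∀ k, 1 ≤ k → k ≤ e → Tendsto (fun x => aeval (m x) (esymm (Fin e) ℂ k)) l (𝓝 0) := by
    intro k h1 h2
    have := ha0.mul (h k h1 h2)
    rw [zero_mul] at this
    refine this.congr' ?_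
    filter_upwards [hne] with x hx
    rw [← mul_assoc, inv_mul_cancel₀ hx, one_mul]
  induction k using Nat.strong_induction_on with
  | _ k ih =>
    have hx : ∀ x, a x * ∑ i, m x i ^ k =
        (-1) ^ (k + 1) * k * (a x * aeval (m x) (esymm (Fin e) ℂ k)) -
        ∑ b ∈ Finset.HasAntidiagonal.antidiagonal k with b.1 ∈ Set.Ioo 0 k,
          (-1) ^ b.1 * aeval (m x) (esymm (Fin e) ℂ b.1) * (a x * ∑ i, m x i ^ b.2) := by
      intro x
      have := congrArg (aeval (m x)) (psum_eq_mul_esymm_sub_sum (Fin e) ℂ k hk)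
      simp only [psum, map_sum, map_sub, map_mul, map_pow, aeval_X, map_neg, map_one,
        map_natCast] at this
      rw [this, mul_sub, Finset.mul_sum]
      congr 1
      · ring
      · exact Finset.sum_congr rfl fun b _ => by ring
    simp_rw [hx]
    -- The factor `a x` goes with the power sum, which converges by induction; the bare `esymm`
    -- tends to `0`, so every correction term vanishes.
    have hs : Tendsto (fun x => ∑ b ∈ Finset.HasAntidiagonal.antidiagonal k with b.1 ∈ Set.Ioo 0 k,
          (-1) ^ b.1 * aeval (m x) (esymm (Fin e) ℂ b.1) * (a x * ∑ i, m x i ^ b.2)) l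
        (𝓝 (∑ b ∈ Finset.HasAntidiagonal.antidiagonal k with b.1 ∈ Set.Ioo 0 k,
          (-1) ^ b.1 * 0 * ((-1) ^ (b.2 + 1) * b.2 * F b.2))) := by
      refine tendsto_finsetSum _ fun b hb => ?_
      rw [Finset.mem_filter, Finset.HasAntidiagonal.mem_antidiagonal, Set.mem_Ioo] at hb
      exact ((he b.1 (by omega) (by omega)).const_mul _).mul
        (ih b.2 (by omega) (by omega) (by omega))
    simpa using ((h k hk hke).const_mul ((-1) ^ (k + 1) * (k : ℂ))).sub hs

/-- Lower semicontinuity of the rank of the matrix `(G (v_a + v_b))` for `G` a limit of scaled sums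
of `e` powers of linear forms of degree `k`. -/
theorem card_le_of_tendsto_sum_pow {α P : Type*} [Fintype P] [DecidableEq P] {l : Filter α} [l.NeBot]
    {e k : ℕ} {a : α → ℂ} {m : α → P → Fin e → ℂ} {F : Matrix P P ℂ}
    (h : ∀ p q, Tendsto (fun x => a x * ∑ i, (m x p i + m x q i) ^ k) l (𝓝 (F p q)))
    (hF : F.det ≠ 0) : Fintype.card P ≤ e * (k + 1) := by
  let M : α → Matrix P P ℂ := fun x => Matrix.of fun p q => a x * ∑ i, (m x p i + m x q i) ^ k
  have hM : Tendsto M l (𝓝 F) := tendsto_pi_nhds.2 fun p => tendsto_pi_nhds.2 fun q => h p q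
  have hdet : Tendsto (fun x => (M x).det) l (𝓝 F.det) :=
    ((continuous_id.matrix_det).tendsto F).comp hM
  obtain ⟨x, hx⟩ := (hdet.eventually_ne hF).exists
  -- By the binomial theorem each of the `e` powers has rank at most `k + 1`.
  let B : Matrix P (Fin e × Fin (k + 1)) ℂ := Matrix.of fun p j => a x * m x p j.1 ^ (j.2 : ℕ)
  let D : Matrix (Fin e × Fin (k + 1)) P ℂ :=
    Matrix.of fun j q => m x q j.1 ^ (k - (j.2 : ℕ)) * (k.choose j.2 : ℂ)
  have hBD : M x = B * D := by
    ext p q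
    simp only [M, B, D, Matrix.mul_apply, Matrix.of_apply, Fintype.sum_prod_type, Finset.mul_sum]
    refine Finset.sum_congr rfl fun i _ => ?_
    rw [add_pow, Finset.mul_sum, ← Fin.sum_univ_eq_sum_range
      (fun j => a x * (m x p i ^ j * m x q i ^ (k - j) * (k.choose j : ℂ)))]
    exact Finset.sum_congr rfl fun j _ => by ring
  have hr : (M x).rank = Fintype.card P :=
    Matrix.rank_of_isUnit _ ((Matrix.isUnit_iff_isUnit_det _).2 (isUnit_iff_ne_zero.2 hx))
  rw [← hr, hBD]
  refine (Matrix.rank_mul_le_left _ _).trans ((Matrix.rank_le_card_width _).trans ?_)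
  simp

/-! ### Limits of a product of linear forms plus a power. -/

/-- Every vector is its norm times a unit vector. -/
theorem exists_norm_eq_one_smul {E : Type*} [NormedAddCommGroup E] [NormedSpace ℂ E] [Nontrivial E]
    (v : E) : ∃ w : E, ‖w‖ = 1 ∧ v = (‖v‖ : ℂ) • w := by
  by_cases hv : v = 0
  · obtain ⟨w, hw⟩ := exists_ne (0 : E)
    exact ⟨(‖w‖ : ℂ)⁻¹ • w, by simp [norm_smul, hw], by simp [hv]⟩
  · refine ⟨(‖v‖ : ℂ)⁻¹ • v, by simp [norm_smul, hv], ?_⟩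
    rw [smul_smul, mul_inv_cancel₀ (by simpa using hv), one_smul]

theorem exists_tendsto_direction {α E : Type*} [NormedAddCommGroup E] [NormedSpace ℂ E]
    [Nontrivial E] [ProperSpace E] (u : Ultrafilter α) (f : α → E) :
    ∃ (w : α → E) (a : E), a ≠ 0 ∧ (∀ x, f x = (‖f x‖ : ℂ) • w x) ∧ Tendsto w u (𝓝 a) := by
  choose w hw hfw using fun x => exists_norm_eq_one_smul (f x)
  obtain ⟨a, ha⟩ := u.exists_tendsto_of_bounded w 1 (Eventually.of_forall fun x => (hw x).le)
  refine ⟨w, a, ?_, hfw, ha⟩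
  rintro rfl
  have := ha.norm
  simp only [hw, norm_zero] at this
  exact one_ne_zero (tendsto_nhds_unique tendsto_const_nhds this)

theorem tendsto_dotProduct {α ι : Type*} [Fintype ι] {l : Filter α} {f : α → ι → ℂ} {a : ι → ℂ}
    (h : Tendsto f l (𝓝 a)) (w : ι → ℂ) : Tendsto (fun x => f x ⬝ᵥ w) l (𝓝 (a ⬝ᵥ w)) :=
  ((Continuous.dotProduct continuous_id continuous_const).tendsto a).comp h

theorem exists_forall_dotProduct_ne_zero {ι κ : Type*} [Fintype ι] [Finite κ] (g : κ → ι → ℂ)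
    (hg : ∀ i, g i ≠ 0) : ∃ w : ι → ℂ, ∀ i, g i ⬝ᵥ w ≠ 0 := by
  classical
  refine Module.Dual.exists_forall_ne_zero_of_forall_exists
    (fun i => dotProductBilin ℂ ℂ (g i)) fun i => ?_
  by_contra! h
  refine hg i ?_
  ext j
  simpa using h (Pi.single j 1)

/-- If the power summand stays bounded, a limit of products plus powers of linear forms is again a
product plus a power. -/
theorem exists_eq_prod_add_pow {α ι : Type*} [Fintype ι] [Nonempty ι] {u : Ultrafilter α} {e : ℕ}
    {ℓ : α → Fin e → ι → ℂ} {κ : α → ι → ℂ} {Φ : (ι → ℂ) → ℂ}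
    (h : ∀ w, Tendsto (fun x => ∏ i, ℓ x i ⬝ᵥ w + (κ x ⬝ᵥ w) ^ e) u (𝓝 (Φ w)))
    (hκ : ∃ R, ∀ᶠ x in (u : Filter α), ‖κ x‖ ≤ R) :
    ∃ (c : ℂ) (g : Fin e → ι → ℂ) (k : ι → ℂ),
      ∀ w, Φ w = c * ∏ i, g i ⬝ᵥ w + (k ⬝ᵥ w) ^ e := by
  obtain ⟨R, hR⟩ := hκ
  obtain ⟨k, hk⟩ := u.exists_tendsto_of_bounded κ R hR
  choose w g hg hℓ hw using fun i => exists_tendsto_direction u (fun x => ℓ x i)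
  -- Dividing by the product of directions at `w₀` shows that the product of the norms converges,
  -- even if single norms do not.
  obtain ⟨w₀, hw₀⟩ := exists_forall_dotProduct_ne_zero g hg
  have hprod : ∀ v x, ∏ i, ℓ x i ⬝ᵥ v = (∏ i, (‖ℓ x i‖ : ℂ)) * ∏ i, w i x ⬝ᵥ v := by
    intro v x
    rw [← Finset.prod_mul_distrib]
    refine Finset.prod_congr rfl fun i _ => ?_
    conv_lhs => rw [hℓ i x]
    rw [smul_dotProduct, smul_eq_mul]
  have hw' : ∀ v, Tendsto (fun x => ∏ i, w i x ⬝ᵥ v) u (𝓝 (∏ i, g i ⬝ᵥ v)) := fun v =>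
    tendsto_finsetProd _ fun i _ => tendsto_dotProduct (hw i) v
  have hP : ∀ v, Tendsto (fun x => (∏ i, (‖ℓ x i‖ : ℂ)) * ∏ i, w i x ⬝ᵥ v) u
      (𝓝 (Φ v - (k ⬝ᵥ v) ^ e)) := by
    intro v
    refine ((h v).sub ((tendsto_dotProduct hk v).pow e)).congr fun x => ?_
    rw [hprod, add_sub_cancel_right]
  have hne : ∏ i, g i ⬝ᵥ w₀ ≠ 0 := Finset.prod_ne_zero_iff.2 fun i _ => hw₀ i
  have hc := (hP w₀).div (hw' w₀) hne
  have hc' : Tendsto (fun x => ∏ i, (‖ℓ x i‖ : ℂ)) u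
      (𝓝 ((Φ w₀ - (k ⬝ᵥ w₀) ^ e) / ∏ i, g i ⬝ᵥ w₀)) := by
    refine hc.congr' ?_
    filter_upwards [(hw' w₀).eventually_ne hne] with x hx
    simp [hx]
  refine ⟨(Φ w₀ - (k ⬝ᵥ w₀) ^ e) / ∏ i, g i ⬝ᵥ w₀, g, k, fun v => ?_⟩
  rw [← tendsto_nhds_unique (hP v) (hc'.mul (hw' v)), sub_add_cancel]

/-- The restriction to a line of a product of linear forms plus a power, as a polynomial. -/
noncomputable def linePoly {ι : Type*} [Fintype ι] {e : ℕ} (ℓ : Fin e → ι → ℂ) (κ w h : ι → ℂ) :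
    Polynomial ℂ :=
  ∏ i, (Polynomial.C (ℓ i ⬝ᵥ h) * Polynomial.X + Polynomial.C (ℓ i ⬝ᵥ w)) +
    (Polynomial.C (κ ⬝ᵥ h) * Polynomial.X + Polynomial.C (κ ⬝ᵥ w)) ^ e

theorem eval_linePoly {ι : Type*} [Fintype ι] {e : ℕ} (ℓ : Fin e → ι → ℂ) (κ w h : ι → ℂ)
    (t : ℂ) : (linePoly ℓ κ w h).eval t =
      ∏ i, ℓ i ⬝ᵥ (w + t • h) + (κ ⬝ᵥ (w + t • h)) ^ e := by
  simp only [linePoly, Polynomial.eval_add, Polynomial.eval_prod, Polynomial.eval_mul,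
    Polynomial.eval_C, Polynomial.eval_X, Polynomial.eval_pow, dotProduct_add, dotProduct_smul,
    smul_eq_mul]
  congr 2
  · exact funext fun i => by ring
  · ring

theorem natDegree_linePoly_le {ι : Type*} [Fintype ι] {e : ℕ} (ℓ : Fin e → ι → ℂ)
    (κ w h : ι → ℂ) : (linePoly ℓ κ w h).natDegree ≤ e := by
  refine Polynomial.natDegree_add_le_of_degree_le ?_ ?_
  · refine (Polynomial.natDegree_prod_le _ _).trans ?_
    refine (Finset.sum_le_sum fun i _ => Polynomial.natDegree_linear_le).trans ?_
    simp
  · refine Polynomial.natDegree_pow_le.trans ?_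
    exact (Nat.mul_le_mul_left e Polynomial.natDegree_linear_le).trans (by simp)

theorem coeff_prod_mul_X_add_C {e : ℕ} (a b : Fin e → ℂ) (ha : ∀ i, a i ≠ 0) {j : ℕ} (hj : j ≤ e) :
    (∏ i, (Polynomial.C (a i) * Polynomial.X + Polynomial.C (b i))).coeff (e - j) =
      (∏ i, a i) * aeval (fun i => b i / a i) (esymm (Fin e) ℂ j) := by
  have h : ∀ i, Polynomial.C (a i) * Polynomial.X + Polynomial.C (b i) =
      Polynomial.C (a i) * (Polynomial.X + Polynomial.C (b i / a i)) := by
    intro i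
    rw [mul_add, ← Polynomial.C_mul, mul_div_cancel₀ _ (ha i)]
  simp_rw [h]
  rw [Finset.prod_mul_distrib, ← map_prod, Polynomial.coeff_C_mul,
    Finset.prod_X_add_C_coeff _ _ (by simp), esymm]
  simp [Nat.sub_sub_self hj]

/-- Since `κ` vanishes at `w`, the power is a multiple of `t^e` and leaves the lower coefficients to
the product. -/
theorem coeff_linePoly {ι : Type*} [Fintype ι] {e : ℕ} {ℓ : Fin e → ι → ℂ} {κ w h : ι → ℂ}
    (hℓ : ∀ i, ℓ i ⬝ᵥ h ≠ 0) (hκ : κ ⬝ᵥ w = 0) {j : ℕ} (hj : 1 ≤ j) (hje : j ≤ e) :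
    (linePoly ℓ κ w h).coeff (e - j) = (∏ i, ℓ i ⬝ᵥ h) *
      aeval (fun i => ℓ i ⬝ᵥ w / ℓ i ⬝ᵥ h) (esymm (Fin e) ℂ j) := by
  rw [linePoly, Polynomial.coeff_add, coeff_prod_mul_X_add_C _ _ hℓ hje, hκ, map_zero, add_zero,
    mul_pow, ← map_pow, Polynomial.coeff_C_mul_X_pow, if_neg (by omega), add_zero]

/-- If the power summand is unbounded with limit direction `k`, then a nonsingular matrix of
coefficients of the limit along a direction `h` transverse to `k` has size at most `e * (j + 1)`. -/
theorem card_le_of_tendsto_prod_add_pow {α ι : Type*} [Fintype ι] [Nonempty ι]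
    {u : Ultrafilter α} {e : ℕ}
    {ℓ : α → Fin e → ι → ℂ} {κ : α → ι → ℂ} {Φ : (ι → ℂ) → ℂ} (he : e ≠ 0)
    (hΦ : ∀ w, Tendsto (fun x => ∏ i, ℓ x i ⬝ᵥ w + (κ x ⬝ᵥ w) ^ e) u (𝓝 (Φ w)))
    (hκ : Tendsto (fun x => ‖κ x‖) u atTop) :
    ∃ k : ι → ℂ, k ≠ 0 ∧ ∀ h : ι → ℂ, k ⬝ᵥ h ≠ 0 → ∀ j, 1 ≤ j → j ≤ e →
      ∀ {P : Type} [Fintype P] [DecidableEq P] (v : P → ι → ℂ) (F : Matrix P P ℂ), F.det ≠ 0 →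
      (∀ p q, ∃ Q : Polynomial ℂ, Q.natDegree ≤ e ∧
        (∀ t, Q.eval t = Φ (v p + v q + (t - (k ⬝ᵥ (v p + v q)) / (k ⬝ᵥ h)) • h)) ∧
        Q.coeff (e - j) = F p q) → Fintype.card P ≤ e * (j + 1) := by
  obtain ⟨w, k, hk, hκw, hw⟩ := exists_tendsto_direction u κ
  refine ⟨k, hk, fun h hkh j hj hje P _ _ v F hF hQ => ?_⟩
  -- `v - s x v • h` is the projection of `v` to the kernel of `κ x` along `h`; using `w` instead of
  -- `κ` makes the limit of `s` visible.
  let s : α → (ι → ℂ) → ℂ := fun x v => (w x ⬝ᵥ v) / (w x ⬝ᵥ h)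
  let m : α → (ι → ℂ) → Fin e → ℂ := fun x v i => ℓ x i ⬝ᵥ (v - s x v • h) / ℓ x i ⬝ᵥ h
  let a : α → ℂ := fun x => ∏ i, ℓ x i ⬝ᵥ h
  have hs : ∀ v, Tendsto (fun x => s x v) u (𝓝 ((k ⬝ᵥ v) / (k ⬝ᵥ h))) := fun v =>
    (tendsto_dotProduct hw v).div (tendsto_dotProduct hw h) hkh
  have hwh : ∀ᶠ x in (u : Filter α), w x ⬝ᵥ h ≠ 0 := (tendsto_dotProduct hw h).eventually_ne hkh
  have hκ0 : ∀ᶠ x in (u : Filter α), ∀ v, κ x ⬝ᵥ (v - s x v • h) = 0 := by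
    filter_upwards [hwh] with x hx v
    rw [hκw, smul_dotProduct, dotProduct_sub, dotProduct_smul, smul_eq_mul,
      smul_eq_mul, div_mul_cancel₀ _ hx, sub_self, mul_zero]
  have hκh : Tendsto (fun x => ‖(κ x ⬝ᵥ h) ^ e‖) u atTop := by
    simp_rw [norm_pow]
    refine (tendsto_pow_atTop he).comp ?_
    have : ∀ x, ‖κ x ⬝ᵥ h‖ = ‖κ x‖ * ‖w x ⬝ᵥ h‖ := by
      intro x
      conv_lhs => rw [hκw x, smul_dotProduct, norm_smul]
      simp
    simp_rw [this]
    exact hκ.atTop_mul_pos (norm_pos_iff.2 hkh) (tendsto_dotProduct hw h).norm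
  -- The sum with the unbounded power converges, so the product must cancel it.
  have ha : Tendsto (fun x => ‖a x‖) u atTop := by
    have hlim : Tendsto (fun x => a x + (κ x ⬝ᵥ h) ^ e) u (𝓝 (Φ h)) := hΦ h
    refine tendsto_atTop_mono (f := fun x => ‖(κ x ⬝ᵥ h) ^ e‖ + -‖a x + (κ x ⬝ᵥ h) ^ e‖)
      (fun x => ?_) (hκh.atTop_add hlim.norm.neg)
    have := norm_sub_le (a x + (κ x ⬝ᵥ h) ^ e) (a x)
    rw [add_sub_cancel_left] at this
    linarith
  have hℓ : ∀ᶠ x in (u : Filter α), ∀ i, ℓ x i ⬝ᵥ h ≠ 0 := by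
    filter_upwards [ha.eventually_gt_atTop 0] with x hx i
    exact Finset.prod_ne_zero_iff.1 (norm_pos_iff.1 hx) i (Finset.mem_univ i)
  have hp : ∀ p q, Tendsto (fun x => a x * ∑ i, (m x (v p) i + m x (v q) i) ^ j) u
      (𝓝 ((-1) ^ (j + 1) * j * F p q)) := by
    intro p q
    obtain ⟨Q, hQe, hQ, hQF⟩ := hQ p q
    set z := v p + v q with hz
    let σ := (k ⬝ᵥ z) / (k ⬝ᵥ h)
    let Q' : Polynomial ℂ := Q.comp (Polynomial.X + Polynomial.C σ)
    have hQ'e : Q'.natDegree ≤ e := by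
      rw [Polynomial.natDegree_comp, Polynomial.natDegree_X_add_C, mul_one]
      exact hQe
    have hQ' : ∀ t, Q'.eval t = Φ (z + t • h) := by
      intro t
      simp only [Q', Polynomial.eval_comp, Polynomial.eval_add, Polynomial.eval_X,
        Polynomial.eval_C, hQ, σ, add_sub_cancel_right]
    have h1 : ∀ i, Tendsto (fun x => (linePoly (ℓ x) (κ x) z h).coeff i) u (𝓝 (Q'.coeff i)) :=
      Polynomial.tendsto_coeff_of_tendsto_eval (fun x => natDegree_linePoly_le _ _ _ _) hQ'e
        fun t _ => by simpa only [eval_linePoly, hQ'] using hΦ (z + t • h)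
    -- The base point moves with `x`; this amounts to evaluating the polynomial of the fixed line at
    -- `t - s x z`.
    have h2 : ∀ i, Tendsto (fun x => (linePoly (ℓ x) (κ x) (z - s x z • h) h).coeff i) u
        (𝓝 (Q.coeff i)) := by
      refine Polynomial.tendsto_coeff_of_tendsto_eval
        (fun x => natDegree_linePoly_le _ _ _ _) hQe fun t _ => ?_
      have := Polynomial.tendsto_eval_of_tendsto_coeff
        (fun x => natDegree_linePoly_le (ℓ x) (κ x) z h) hQ'e h1 ((hs z).const_sub t)
      rw [hQ' , ← hQ] at this
      refine this.congr fun x => ?_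
      rw [eval_linePoly, eval_linePoly]
      have : z + (t - s x z) • h = z - s x z • h + t • h := by
        rw [sub_smul]
        abel
      rw [this]
    have h3 := tendsto_mul_psum (m := fun x => m x z) (F := fun i => Q.coeff (e - i)) ha
      (fun i hi hie => by
        refine (h2 (e - i)).congr' ?_
        filter_upwards [hℓ, hκ0] with x hx hx'
        exact coeff_linePoly hx (hx' z) hi hie) j hj hje
    rw [← hQF]
    refine h3.congr fun x => ?_
    congr 1
    refine Finset.sum_congr rfl fun i _ => ?_
    congr 1
    simp only [m, s, hz, dotProduct_add, dotProduct_sub, dotProduct_smul, smul_eq_mul]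
    ring
  have hcard := card_le_of_tendsto_sum_pow (P := P)
    (F := ((-1) ^ (j + 1) * (j : ℂ)) • F) (e := e) (k := j) (a := a)
    (m := fun x p => m x (v p)) (l := (u : Filter α)) (fun p q => hp p q) ?_
  · exact hcard
  · rw [Matrix.det_smul]
    refine mul_ne_zero (pow_ne_zero _ (mul_ne_zero (pow_ne_zero _ (by norm_num)) ?_)) hF
    exact_mod_cast (by omega : j ≠ 0)

/-! ### From the closure to a limit of homogeneous forms. -/

theorem eval_sumProdPow {r s d : ℕ} (v : (Fin r × Fin d) ⊕ Fin s → ℂ) :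
    eval v (sumProdPow r s d) =
      ∑ i, ∏ j, v (Sum.inl (i, j)) + ∑ i, v (Sum.inr i) ^ d := by
  simp [sumProdPow]

theorem eval_affineSubst {σ τ : Type*} [Fintype σ] (A : Matrix τ σ ℂ) (b : τ → ℂ)
    (g : MvPolynomial τ ℂ) (v : σ → ℂ) :
    eval v (affineSubst A b g) = eval (fun j => A j ⬝ᵥ v + b j) g := by
  rw [affineSubst, aeval_def, eval_eval₂]
  have hC : (eval v).comp (C : ℂ →+* MvPolynomial σ ℂ) = RingHom.id ℂ := by
    ext; simp
  simp only [algebraMap_eq, hC, map_add, map_sum, map_mul, eval_C, eval_X]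
  rfl

theorem totalDegree_affineSubst_sumProdPow_le {σ : Type*} [Fintype σ] {r s d : ℕ}
    (A : Matrix ((Fin r × Fin d) ⊕ Fin s) σ ℂ) (b : (Fin r × Fin d) ⊕ Fin s → ℂ) :
    (affineSubst A b (sumProdPow r s d)).totalDegree ≤ d := by
  have h : ∀ j, (∑ i : σ, C (A j i) * X i + C (b j) : MvPolynomial σ ℂ).totalDegree ≤ 1 := by
    intro j
    refine (totalDegree_add _ _).trans (max_le ?_ (by simp))
    refine totalDegree_finsetSum_le fun i _ => ?_
    refine (totalDegree_mul _ _).trans ?_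
    simp
  simp only [affineSubst, sumProdPow, map_add, map_sum, map_prod, map_pow, aeval_X]
  refine (totalDegree_add _ _).trans (max_le ?_ ?_)
  · refine totalDegree_finsetSum_le fun i _ => ?_
    refine (totalDegree_finsetProd _ _).trans ?_
    exact (Finset.sum_le_sum fun j _ => h _).trans (by simp)
  · refine totalDegree_finsetSum_le fun i _ => ?_
    refine (totalDegree_pow _ _).trans ?_
    exact (Nat.mul_le_mul_left d (h _)).trans (by simp)

/-- The index set depends only on `n`, so coefficientwise convergence passes to values. -/
theorem eval_eq_sum_Iic {σ : Type*} [Fintype σ] [DecidableEq σ] {p : MvPolynomial σ ℂ} {n : ℕ}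
    (hp : p.totalDegree ≤ n) (v : σ → ℂ) :
    eval v p = ∑ m ∈ Finset.Iic (Finsupp.equivFunOnFinite.symm fun _ : σ => n),
      coeff m p * ∏ i, v i ^ m i := by
  rw [eval_eq']
  refine Finset.sum_subset (fun m hm => ?_) fun m _ hm => ?_
  · rw [Finset.mem_Iic, Finsupp.le_def]
    intro i
    refine le_trans ?_ ((le_totalDegree hm).trans hp)
    by_cases hi : i ∈ m.support
    · exact Finset.single_le_sum (f := fun i => m i) (fun _ _ => Nat.zero_le _) hi
    · simp [Finsupp.notMem_support_iff.1 hi]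
  · rw [notMem_support_iff.1 hm, zero_mul]

/-- The vector `(z, v)`. -/
def homVec {σ : Type*} (z : ℂ) (v : σ → ℂ) : Option σ → ℂ := fun o => o.elim z v

theorem dotProduct_homVec {σ : Type*} [Fintype σ] (g : Option σ → ℂ) (z : ℂ) (v : σ → ℂ) :
    g ⬝ᵥ homVec z v = g none * z + (fun i => g (some i)) ⬝ᵥ v := by
  simp [dotProduct, homVec, Fintype.sum_option]

theorem AffDegeneration.exists_tendsto {σ : Type*} [Fintype σ] {f : MvPolynomial σ ℂ} {e : ℕ}
    (h : AffDegeneration f (sumProdPow 1 1 e)) :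
    ∃ (u : Ultrafilter ((σ →₀ ℕ) → ℂ)) (ℓ : ((σ →₀ ℕ) → ℂ) → Fin e → Option σ → ℂ)
      (κ : ((σ →₀ ℕ) → ℂ) → Option σ → ℂ), ∀ v : σ → ℂ,
      Tendsto (fun x => ∏ i, ℓ x i ⬝ᵥ homVec 1 v + (κ x ⬝ᵥ homVec 1 v) ^ e) u
        (𝓝 (eval v f)) := by
  classical
  obtain ⟨u, hu, hle⟩ := mem_closure_iff_ultrafilter.1 h
  have hex : ∀ x : (σ →₀ ℕ) → ℂ, ∃ (A : Matrix ((Fin 1 × Fin e) ⊕ Fin 1) σ ℂ)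
      (b : (Fin 1 × Fin e) ⊕ Fin 1 → ℂ),
      x ∈ coeffVec '' affineProjections σ (sumProdPow 1 1 e) →
        x = coeffVec (affineSubst A b (sumProdPow 1 1 e)) := by
    intro x
    by_cases hx : x ∈ coeffVec '' affineProjections σ (sumProdPow 1 1 e)
    · obtain ⟨p, ⟨A, b, rfl⟩, rfl⟩ := hx
      exact ⟨A, b, fun _ => rfl⟩
    · exact ⟨0, 0, fun h => absurd h hx⟩
  choose A b hAb using hex
  refine ⟨u, fun x i => homVec (b x (Sum.inl (0, i))) (A x (Sum.inl (0, i))),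
    fun x => homVec (b x (Sum.inr 0)) (A x (Sum.inr 0)), fun v => ?_⟩
  rw [eval_eq_sum_Iic (le_max_right e _)]
  have hx : ∀ᶠ x in (u : Filter _),
      ∑ m ∈ Finset.Iic (Finsupp.equivFunOnFinite.symm fun _ : σ => max e f.totalDegree),
        x m * ∏ i, v i ^ m i =
      ∏ i, homVec (b x (Sum.inl (0, i))) (A x (Sum.inl (0, i))) ⬝ᵥ homVec 1 v +
        (homVec (b x (Sum.inr 0)) (A x (Sum.inr 0)) ⬝ᵥ homVec 1 v) ^ e := by
    filter_upwards [hu] with x hx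
    have h1 := eval_eq_sum_Iic ((totalDegree_affineSubst_sumProdPow_le (A x) (b x)).trans
      (le_max_left e f.totalDegree)) v
    rw [eval_affineSubst, eval_sumProdPow] at h1
    have h2 : ∀ m, x m = coeff m (affineSubst (A x) (b x) (sumProdPow 1 1 e)) :=
      fun m => congrFun (hAb x hx) m
    simp_rw [h2]
    rw [← h1]
    simp [dotProduct_homVec, homVec, add_comm]
  refine Tendsto.congr' hx (tendsto_finsetSum _ fun m _ => Tendsto.mul_const _ ?_)
  exact (tendsto_pi_nhds.1 (tendsto_id.mono_left hle)) m

/-- Convergence to a homogeneous function extends to the homogenisation. -/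
theorem tendsto_homogenization {α σ : Type*} [Fintype σ] {l : Filter α} {d e : ℕ} (hde : d ≤ e)
    {ℓ : α → Fin e → Option σ → ℂ} {κ : α → Option σ → ℂ} {f : (σ → ℂ) → ℂ}
    (hf : ∀ (c : ℂ) v, f (c • v) = c ^ d * f v)
    (h : ∀ v, Tendsto (fun x => ∏ i, ℓ x i ⬝ᵥ homVec 1 v + (κ x ⬝ᵥ homVec 1 v) ^ e) l (𝓝 (f v)))
    (w : Option σ → ℂ) :
    Tendsto (fun x => ∏ i, ℓ x i ⬝ᵥ w + (κ x ⬝ᵥ w) ^ e) l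
      (𝓝 (w none ^ (e - d) * f fun i => w (some i))) := by
  have h0 : ∀ (z : ℂ) v, z ≠ 0 →
      Tendsto (fun x => ∏ i, ℓ x i ⬝ᵥ homVec z v + (κ x ⬝ᵥ homVec z v) ^ e) l
        (𝓝 (z ^ (e - d) * f v)) := by
    intro z v hz
    have hv : homVec z v = z • homVec 1 (z⁻¹ • v) := by
      ext o
      cases o <;> simp [homVec, hz]
    have hfv : z ^ (e - d) * f v = z ^ e * f (z⁻¹ • v) := by
      rw [hf, ← mul_assoc, inv_pow, pow_sub₀ z hz hde]
    rw [hfv]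
    refine ((h (z⁻¹ • v)).const_mul (z ^ e)).congr fun x => ?_
    rw [hv]
    simp only [dotProduct_smul, smul_eq_mul, mul_pow, Finset.prod_mul_distrib,
      Finset.prod_const, Finset.card_univ, Fintype.card_fin]
    ring
  let v : σ → ℂ := fun i => w (some i)
  -- Scaling only reaches `z ≠ 0`; convergence of coefficients along the `z`-line supplies `z = 0`.
  have hl := Polynomial.tendsto_coeff_of_tendsto_eval (l := l) (n := e)
    (q := fun x => linePoly (ℓ x) (κ x) (homVec 0 v) (homVec 1 0))
    (Q := Polynomial.C (f v) * Polynomial.X ^ (e - d))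
    (fun x => natDegree_linePoly_le _ _ _ _)
    ((Polynomial.natDegree_C_mul_X_pow_le _ _).trans (Nat.sub_le _ _)) fun t ht => by
      have hv : homVec 0 v + t • homVec 1 0 = homVec t v := by
        ext o
        cases o <;> simp [homVec]
      simp only [eval_linePoly, hv, Polynomial.eval_mul, Polynomial.eval_C, Polynomial.eval_pow,
        Polynomial.eval_X]
      rw [mul_comm]
      exact h0 t v ht
  have := Polynomial.tendsto_eval_of_tendsto_coeff (fun x => natDegree_linePoly_le _ _ _ _)
    ((Polynomial.natDegree_C_mul_X_pow_le _ _).trans (Nat.sub_le _ _)) hl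
    (tendsto_const_nhds (x := w none))
  have hv : homVec 0 v + w none • homVec 1 0 = w := by
    ext o
    cases o <;> simp [homVec, v]
  simpa only [eval_linePoly, hv, Polynomial.eval_mul, Polynomial.eval_C, Polynomial.eval_pow,
    Polynomial.eval_X, mul_comm (f v)] using this

theorem eval_sumProdPow_smul {s d : ℕ} (c : ℂ) (v : (Fin 1 × Fin d) ⊕ Fin s → ℂ) :
    eval (c • v) (sumProdPow 1 s d) = c ^ d * eval v (sumProdPow 1 s d) := by
  simp [eval_sumProdPow, mul_pow, Finset.prod_mul_distrib, mul_add, Finset.mul_sum]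

/-- Degrees do not drop under affine degenerations to `sumProdPow 1 2 d`. -/
theorem AffDegeneration.le_of_sumProdPow {d e : ℕ} (hd : d ≠ 0)
    (h : AffDegeneration (sumProdPow 1 2 d) (sumProdPow 1 1 e)) : d ≤ e := by
  by_contra! hed
  obtain ⟨u, ℓ, κ, hu⟩ := h.exists_tendsto
  let y : (Fin 1 × Fin d) ⊕ Fin 2 → ℂ := Pi.single (Sum.inr 0) 1
  have hl := Polynomial.tendsto_coeff_of_tendsto_eval (l := (u : Filter _)) (n := d)
    (q := fun x => linePoly (ℓ x) (κ x) (homVec 1 0) (homVec 0 y))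
    (Q := Polynomial.X ^ d) (fun x => (natDegree_linePoly_le _ _ _ _).trans hed.le)
    (Polynomial.natDegree_X_pow_le d) (fun t _ => by
      have hv : homVec 1 0 + t • homVec 0 y = homVec 1 (t • y) := by
        ext o
        cases o <;> simp [homVec]
      have hf : eval (t • y) (sumProdPow 1 2 d) = t ^ d := by
        rw [eval_sumProdPow_smul, eval_sumProdPow]
        simp [y, hd]
      simp only [eval_linePoly, hv, Polynomial.eval_pow, Polynomial.eval_X]
      rw [← hf]
      exact hu _) d
  have h0 : ∀ x, (linePoly (ℓ x) (κ x) (homVec 1 0) (homVec 0 y)).coeff d = 0 := fun x =>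
    Polynomial.coeff_eq_zero_of_natDegree_lt ((natDegree_linePoly_le _ _ _ _).trans_lt hed)
  simp only [h0, Polynomial.coeff_X_pow_self] at hl
  exact zero_ne_one (tendsto_nhds_unique tendsto_const_nhds hl)

/-! ### Bounded power summand: contradiction. -/

theorem eval_sumProdPow_one_two {d : ℕ} (v : (Fin 1 × Fin d) ⊕ Fin 2 → ℂ) :
    eval v (sumProdPow 1 2 d) =
      ∏ j, v (Sum.inl (0, j)) + (v (Sum.inr 0) ^ d + v (Sum.inr 1) ^ d) := by
  simp [eval_sumProdPow]

/-- The vector with the given coordinates in the variables `x_j` and `y_i`. -/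
def xyVec {d : ℕ} (x : Fin d → ℂ) (y : Fin 2 → ℂ) : (Fin 1 × Fin d) ⊕ Fin 2 → ℂ :=
  Sum.elim (fun j => x j.2) y

theorem dotProduct_xyVec {d : ℕ} (g : (Fin 1 × Fin d) ⊕ Fin 2 → ℂ) (x : Fin d → ℂ) (y : Fin 2 → ℂ) :
    g ⬝ᵥ xyVec x y = ∑ j, g (Sum.inl (0, j)) * x j +
      (g (Sum.inr 0) * y 0 + g (Sum.inr 1) * y 1) := by
  simp [dotProduct, xyVec, Fintype.sum_prod_type]

theorem xyVec_eta {d : ℕ} (v : (Fin 1 × Fin d) ⊕ Fin 2 → ℂ) :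
    xyVec (fun j => v (Sum.inl (0, j))) (fun i => v (Sum.inr i)) = v := by
  ext (⟨i, j⟩ | i)
  · simp [xyVec, Subsingleton.elim i 0]
  · rfl

theorem eval_xyVec {d : ℕ} (x : Fin d → ℂ) (y : Fin 2 → ℂ) :
    eval (xyVec x y) (sumProdPow 1 2 d) = ∏ j, x j + (y 0 ^ d + y 1 ^ d) := by
  simp [eval_sumProdPow_one_two, xyVec]

theorem xyVec_add {d : ℕ} (x x' : Fin d → ℂ) (y y' : Fin 2 → ℂ) :
    xyVec x y + xyVec x' y' = xyVec (x + x') (y + y') := by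
  ext (⟨i, j⟩ | i) <;> simp [xyVec]

theorem xyVec_smul {d : ℕ} (t : ℂ) (x : Fin d → ℂ) (y : Fin 2 → ℂ) :
    t • xyVec x y = xyVec (t • x) (t • y) := by
  ext (⟨i, j⟩ | i) <;> simp [xyVec]

/-- Two linear equations in at least three unknowns have a nontrivial solution. -/
theorem exists_ne_zero_of_two_equations {d : ℕ} (hd : 3 ≤ d) (a b : Fin d → ℂ) :
    ∃ x : Fin d → ℂ, x ≠ 0 ∧ ∑ j, a j * x j = 0 ∧ ∑ j, b j * x j = 0 := by
  let φ : (Fin d → ℂ) →ₗ[ℂ] ℂ × ℂ := (dotProductBilin ℂ ℂ a).prod (dotProductBilin ℂ ℂ b)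
  have hφ : φ.ker ≠ ⊥ := LinearMap.ker_ne_bot_of_finrank_lt (by simp; omega)
  obtain ⟨x, hx, hx0⟩ := (Submodule.ne_bot_iff _).1 hφ
  have := LinearMap.mem_ker.1 hx
  exact ⟨x, hx0, congrArg Prod.fst this, congrArg Prod.snd this⟩

/-- On no affine hyperplane is `sumProdPow 1 2 d` a constant plus a power of an affine form. -/
theorem not_forall_eval_eq_add_pow {d e : ℕ} (hd : 3 ≤ d) (g v₀ k : (Fin 1 × Fin d) ⊕ Fin 2 → ℂ)
    (c r : ℂ) : ¬ ∀ v, g ⬝ᵥ v = 0 → eval (v₀ + v) (sumProdPow 1 2 d) = c + (r + k ⬝ᵥ v) ^ e := by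
  intro H
  have hinv : ∀ v h, g ⬝ᵥ v = 0 → g ⬝ᵥ h = 0 → k ⬝ᵥ h = 0 →
      eval (v₀ + (v + h)) (sumProdPow 1 2 d) = eval (v₀ + v) (sumProdPow 1 2 d) := by
    intro v h hv hh hk
    rw [H _ hv, H _ (by rw [dotProduct_add, hv, hh, add_zero]), dotProduct_add, hk, add_zero]
  obtain ⟨x₀, y₀, rfl⟩ : ∃ x y, v₀ = xyVec x y := ⟨_, _, (xyVec_eta v₀).symm⟩
  -- If the hyperplane does not constrain `y`, some nonzero `(a, b)` in the `y`-plane is killed by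
  -- `k`, and `y^d + z^d` would be invariant under translation by it.
  by_cases hg : g (Sum.inr 0) = 0 ∧ g (Sum.inr 1) = 0
  · obtain ⟨a, b, hab, hk⟩ : ∃ a b : ℂ, (a ≠ 0 ∨ b ≠ 0) ∧
        k (Sum.inr 0) * a + k (Sum.inr 1) * b = 0 := by
      by_cases h1 : k (Sum.inr 1) = 0
      · exact ⟨0, 1, Or.inr one_ne_zero, by simp [h1]⟩
      · exact ⟨k (Sum.inr 1), -k (Sum.inr 0), Or.inl h1, by ring⟩
    have key : ∀ y z : ℂ, (y + a) ^ d + (z + b) ^ d = y ^ d + z ^ d := by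
      intro y z
      have := hinv (xyVec 0 ![y - y₀ 0, z - y₀ 1]) (xyVec 0 ![a, b])
        (by simp [dotProduct_xyVec, hg]) (by simp [dotProduct_xyVec, hg])
        (by simpa [dotProduct_xyVec] using hk)
      simp only [xyVec_add, eval_xyVec] at this
      simp only [Pi.add_apply, Matrix.cons_val_zero, Matrix.cons_val_one, add_zero, ← add_assoc,
        Pi.zero_apply, add_sub_cancel] at this
      linear_combination this
    have two : ((2 : ℂ) ^ d) ≠ 2 := by
      have h2 : 2 ^ d ≠ 2 := by
        have := Nat.pow_lt_pow_right (a := 2) (by norm_num) (by omega : 1 < d)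
        omega
      exact_mod_cast h2
    have h0 := key 0 0
    have ha := key a 0
    have hb := key 0 b
    have hd0 : d ≠ 0 := by omega
    simp only [zero_add, zero_pow hd0, add_zero] at h0 ha hb
    rw [← two_mul, mul_pow] at ha hb
    rcases hab with h | h
    · have : ((2 : ℂ) ^ d - 2) * a ^ d = 0 := by linear_combination ha - h0
      exact (mul_ne_zero (sub_ne_zero.2 two) (pow_ne_zero d h)) this
    · have : ((2 : ℂ) ^ d - 2) * b ^ d = 0 := by linear_combination hb - h0
      exact (mul_ne_zero (sub_ne_zero.2 two) (pow_ne_zero d h)) this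
  -- Otherwise `y` can be solved for so that all `x`-coordinates equal `1`. A translation in `x`
  -- killed by both `g` and `k` then makes one coordinate `0`: the product drops from `1` to `0`
  -- while `y` is unchanged.
  · obtain ⟨x, hx, hxg, hxk⟩ := exists_ne_zero_of_two_equations hd
      (fun j => g (Sum.inl (0, j))) (fun j => k (Sum.inl (0, j)))
    obtain ⟨j, hj⟩ := Function.ne_iff.1 hx
    obtain ⟨y, hy⟩ : ∃ y : Fin 2 → ℂ, g ⬝ᵥ xyVec (1 - x₀) y = 0 := by
      simp only [dotProduct_xyVec]
      generalize ∑ j, g (Sum.inl (0, j)) * (1 - x₀) j = s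
      by_cases h0 : g (Sum.inr 0) = 0
      · have h1 : g (Sum.inr 1) ≠ 0 := fun h1 => hg ⟨h0, h1⟩
        refine ⟨![0, -s / g (Sum.inr 1)], ?_⟩
        simp [h0, mul_div_cancel₀ _ h1]
      · refine ⟨![-s / g (Sum.inr 0), 0], ?_⟩
        simp [mul_div_cancel₀ _ h0]
    have := hinv (xyVec (1 - x₀) y) (xyVec ((-(x j)⁻¹) • x) 0) hy
      (by simp [dotProduct_xyVec, mul_left_comm, ← Finset.mul_sum, hxg])
      (by simp [dotProduct_xyVec, mul_left_comm, ← Finset.mul_sum, hxk])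
    simp only [xyVec_add, eval_xyVec] at this
    have hprod : ∏ i, (x₀ + (1 - x₀ + (-(x j)⁻¹) • x)) i = 0 := by
      refine Finset.prod_eq_zero (Finset.mem_univ j) ?_
      have : x j ≠ 0 := hj
      simp [this]
      ring
    rw [hprod] at this
    simp at this

/-- On the zero set of a nonconstant factor the product disappears; if there is no such factor, it
is a constant. -/
theorem not_forall_eq_prod_add_pow {d e : ℕ} (hd : 3 ≤ d) (c : ℂ)
    (g : Fin e → Option ((Fin 1 × Fin d) ⊕ Fin 2) → ℂ) (k : Option ((Fin 1 × Fin d) ⊕ Fin 2) → ℂ) :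
    ¬ ∀ v, eval v (sumProdPow 1 2 d) = c * ∏ i, g i ⬝ᵥ homVec 1 v + (k ⬝ᵥ homVec 1 v) ^ e := by
  intro H
  simp only [dotProduct_homVec, mul_one] at H
  by_cases hg : ∃ i, (fun j => g i (some j)) ≠ 0
  · obtain ⟨i, hi⟩ := hg
    obtain ⟨j, hj⟩ := Function.ne_iff.1 hi
    let v₀ : (Fin 1 × Fin d) ⊕ Fin 2 → ℂ := Pi.single j (-g i none / g i (some j))
    have hv₀ : g i none + (fun j => g i (some j)) ⬝ᵥ v₀ = 0 := by
      have : g i (some j) ≠ 0 := hj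
      simp [v₀, mul_div_cancel₀ _ this]
    refine not_forall_eval_eq_add_pow (e := e) hd (fun j => g i (some j)) v₀ (fun j => k (some j)) 0
      (k none + (fun j => k (some j)) ⬝ᵥ v₀) fun v hv => ?_
    rw [H, Finset.prod_eq_zero (Finset.mem_univ i), mul_zero, dotProduct_add, add_assoc]
    rw [dotProduct_add, hv, add_zero, hv₀]
  · push Not at hg
    refine not_forall_eval_eq_add_pow (e := e) hd 0 0 (fun j => k (some j)) (c * ∏ i, g i none)
      (k none) fun v _ => ?_
    rw [zero_add, H]
    simp [hg]

/-! ### Unbounded power summand: the exponential count. -/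

/-- The vector of signs `±1` of a Boolean vector, with the entry `1 / 2` inserted at `p`. -/
noncomputable def signVec {n : ℕ} (p : Fin (n + 1)) (a : Fin n → Bool) : Fin (n + 1) → ℂ :=
  p.insertNth (1 / 2) fun j => if a j then 1 else -1

/-- Distinct sign vectors cancel in some coordinate, so the matrix is diagonal, with products of
`±2` on the diagonal. -/
theorem det_prod_signVec_ne_zero {n : ℕ} (p : Fin (n + 1)) :
    (Matrix.of fun a b : Fin n → Bool =>
      ∏ j, (signVec p a + signVec p b) (p.succAbove j)).det ≠ 0 := by
  have h : (Matrix.of fun a b : Fin n → Bool =>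
      ∏ j, (signVec p a + signVec p b) (p.succAbove j)) =
      Matrix.diagonal fun a => ∏ j, (signVec p a + signVec p a) (p.succAbove j) := by
    ext a b
    by_cases hab : a = b
    · simp [hab]
    · obtain ⟨j, hj⟩ := Function.ne_iff.1 hab
      rw [Matrix.diagonal_apply_ne _ hab, Matrix.of_apply]
      refine Finset.prod_eq_zero (Finset.mem_univ j) ?_
      cases ha : a j <;> cases hb : b j <;> simp_all [signVec]
  rw [h, Matrix.det_diagonal]
  refine Finset.prod_ne_zero_iff.2 fun a _ => Finset.prod_ne_zero_iff.2 fun j _ => ?_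
  cases ha : a j <;> simp [signVec, ha]

/-- The reason for the entry `1 / 2`: coordinate `p` drops out of the full product. -/
theorem signVec_add_apply_self {n : ℕ} (p : Fin (n + 1)) (a b : Fin n → Bool) :
    (signVec p a + signVec p b) p = 1 := by
  simp [signVec]
  norm_num

theorem homVec_add {σ : Type*} (z z' : ℂ) (v v' : σ → ℂ) :
    homVec z v + homVec z' v' = homVec (z + z') (v + v') := by
  ext o
  cases o <;> rfl

theorem homVec_smul {σ : Type*} (t z : ℂ) (v : σ → ℂ) :
    t • homVec z v = homVec (t * z) (t • v) := by
  ext o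
  cases o <;> rfl

/-- `h` is a coordinate direction on which `k` is nonzero. Whether it is `z`, some `x_p` or some
`y_i`, the coefficient of `t^(e-d)`, `t` or `1` respectively (with `d = n + 1`) is the product of
the remaining `x`-variables. -/
theorem two_pow_le_of_tendsto_atTop {α : Type*} {u : Ultrafilter α} {n e : ℕ} (hn : n ≠ 0)
    (hne : n + 1 ≤ e) {ℓ : α → Fin e → Option ((Fin 1 × Fin (n + 1)) ⊕ Fin 2) → ℂ}
    {κ : α → Option ((Fin 1 × Fin (n + 1)) ⊕ Fin 2) → ℂ}
    (hΦ : ∀ w, Tendsto (fun x => ∏ i, ℓ x i ⬝ᵥ w + (κ x ⬝ᵥ w) ^ e) u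
      (𝓝 (w none ^ (e - (n + 1)) * eval (fun i => w (some i)) (sumProdPow 1 2 (n + 1)))))
    (hκ : Tendsto (fun x => ‖κ x‖) u atTop) : 2 ^ n ≤ e * (e + 1) := by
  obtain ⟨k, hk, H⟩ := card_le_of_tendsto_prod_add_pow (by omega) hΦ hκ
  have hv : ∀ (p : Fin (n + 1)) (a b : Fin n → Bool),
      homVec (1 / 2) (xyVec (signVec p a) 0) + homVec (1 / 2) (xyVec (signVec p b) 0) =
        homVec 1 (xyVec (signVec p a + signVec p b) 0) := by
    intro p a b
    rw [homVec_add, xyVec_add, add_zero]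
    norm_num
  have hfin : ∀ (h : Option ((Fin 1 × Fin (n + 1)) ⊕ Fin 2) → ℂ), k ⬝ᵥ h ≠ 0 →
      ∀ j, 1 ≤ j → j ≤ e → ∀ p : Fin (n + 1),
      (∀ (x : Fin (n + 1) → ℂ) (c : ℂ), x p = 1 → ∏ i, x (p.succAbove i) = c →
        ∃ Q : Polynomial ℂ, Q.natDegree ≤ e ∧
        (∀ t, Q.eval t =
          (homVec 1 (xyVec x 0) +
            (t - (k ⬝ᵥ homVec 1 (xyVec x 0)) / (k ⬝ᵥ h)) • h) none
              ^ (e - (n + 1)) *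
          eval (fun i => (homVec 1 (xyVec x 0) +
            (t - (k ⬝ᵥ homVec 1 (xyVec x 0)) / (k ⬝ᵥ h)) • h) (some i))
            (sumProdPow 1 2 (n + 1))) ∧
        Q.coeff (e - j) = c) →
      2 ^ n ≤ e * (e + 1) := by
    intro h hh j hj hje p hQ
    have := H h hh j hj hje (fun a => homVec (1 / 2) (xyVec (signVec p a) 0)) _
      (det_prod_signVec_ne_zero p) (by
        intro a b
        rw [hv]
        exact hQ (signVec p a + signVec p b) _ (signVec_add_apply_self p a b) rfl)
    rw [Fintype.card_pi] at this
    simp only [Fintype.card_bool, Finset.prod_const, Finset.card_univ, Fintype.card_fin] at this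
    exact this.trans (Nat.mul_le_mul_left e (by omega))
  by_cases hz : k none = 0
  · by_cases hx : ∀ p, k (some (Sum.inl (0, p))) = 0
    · obtain ⟨i, hi⟩ : ∃ i, k (some (Sum.inr i)) ≠ 0 := by
        by_contra! hy
        refine hk ?_
        ext (_ | ⟨i, j⟩ | i)
        · exact hz
        · rw [Subsingleton.elim i 0]
          exact hx j
        · exact hy i
      refine hfin (homVec 0 (xyVec 0 (Pi.single i 1))) ?_ e (by omega) le_rfl 0 fun x c hxp hc => ?_
      · fin_cases i <;> simpa [dotProduct_homVec, dotProduct_xyVec, Fin.ext_iff] using hi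
      · refine ⟨Polynomial.C c +
          Polynomial.X ^ (n + 1), ?_, fun t => ?_, by simp⟩
        · refine Polynomial.natDegree_add_le_of_degree_le (by simp) ?_
          simpa using hne
        -- Here the shift must vanish, as it would alter the constant term; in the other cases the
        -- coefficient read off is the leading one.
        · have h0 : k ⬝ᵥ homVec 1 (xyVec x 0) = 0 := by
            simp [dotProduct_homVec, dotProduct_xyVec, hz, hx]
          rw [h0, zero_div, sub_zero, homVec_smul, homVec_add, xyVec_smul, xyVec_add]
          simp only [homVec, Option.elim]
          rw [eval_xyVec, smul_zero, add_zero, Fin.prod_univ_succAbove _ 0, hxp, hc]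
          fin_cases i <;> simp
    · push Not at hx
      obtain ⟨p, hp⟩ := hx
      refine hfin (homVec 0 (xyVec (Pi.single p 1) 0)) ?_ (e - 1) (by omega) (by omega) p
        fun x c hxp hc => ?_
      · simpa [dotProduct_homVec, dotProduct_xyVec, Pi.single_apply] using hp
      · generalize (k ⬝ᵥ homVec 1 (xyVec x 0)) /
          (k ⬝ᵥ homVec 0 (xyVec (Pi.single p 1) 0)) = s
        refine ⟨(Polynomial.X + Polynomial.C (1 - s)) *
          Polynomial.C c, ?_, fun t => ?_, ?_⟩
        · refine (Polynomial.natDegree_mul_C_le _ _).trans ?_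
          rw [Polynomial.natDegree_X_add_C]
          omega
        · rw [homVec_smul, homVec_add, xyVec_smul, xyVec_add]
          simp only [homVec, Option.elim]
          rw [eval_xyVec, Fin.prod_univ_succAbove _ p, Pi.add_apply, hxp]
          simp [hc]
          exact Or.inl (by ring)
        · rw [Nat.sub_sub_self (by omega), Polynomial.coeff_mul_C]
          simp [-map_sub]
  · refine hfin (homVec 1 0) ?_ (n + 1) (by omega) hne 0 fun x c hxp hc => ?_
    · simpa [dotProduct_homVec] using hz
    · generalize (k ⬝ᵥ homVec 1 (xyVec x 0)) /
          (k ⬝ᵥ homVec 1 0) = s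
      refine ⟨(Polynomial.X + Polynomial.C (1 - s)) ^ (e - (n + 1)) *
          Polynomial.C c, ?_, fun t => ?_, ?_⟩
      · refine (Polynomial.natDegree_mul_C_le _ _).trans (Polynomial.natDegree_pow_le.trans ?_)
        rw [Polynomial.natDegree_X_add_C]
        omega
      · rw [homVec_smul, homVec_add]
        simp only [homVec, Option.elim]
        rw [smul_zero, add_zero, eval_xyVec, Fin.prod_univ_succAbove _ 0, hxp, hc]
        simp
        exact Or.inl (by ring)
      · rw [Polynomial.coeff_mul_C, Polynomial.coeff_X_add_C_pow]
        simp

/-- The exponential lower bound. -/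
theorem AffDegeneration.two_pow_le {d e : ℕ} (hd : 2 ≤ d)
    (h : AffDegeneration (sumProdPow 1 2 d) (sumProdPow 1 1 e)) : 2 ^ d ≤ e ^ 6 := by
  have hde := h.le_of_sumProdPow (by omega)
  -- The bounded case needs `d ≥ 3`; for `d = 2` the bound `d ≤ e` suffices.
  obtain rfl | hd3 : d = 2 ∨ 3 ≤ d := by omega
  · calc 2 ^ 2 ≤ 2 ^ 6 := by norm_num
      _ ≤ e ^ 6 := Nat.pow_le_pow_left hde 6
  obtain ⟨u, ℓ, κ, hu⟩ := h.exists_tendsto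
  have hΦ := tendsto_homogenization hde (fun c v => eval_sumProdPow_smul c v) hu
  rcases u.bounded_or_tendsto_atTop (fun x => ‖κ x‖) with hb | hb
  · obtain ⟨c, g, k, H⟩ := exists_eq_prod_add_pow hΦ hb
    refine absurd (fun v => ?_) (not_forall_eq_prod_add_pow hd3 c g k)
    simpa [homVec] using H (homVec 1 v)
  · obtain ⟨n, rfl⟩ : ∃ n, d = n + 1 := ⟨d - 1, by omega⟩
    have := two_pow_le_of_tendsto_atTop (by omega) hde hΦ hb
    calc 2 ^ (n + 1) = 2 * 2 ^ n := by ring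
      _ ≤ e * (e * (e + e)) := Nat.mul_le_mul (by omega)
          (this.trans (Nat.mul_le_mul_left e (by omega)))
      _ = 2 * e ^ 3 := by ring
      _ ≤ e ^ 3 * e ^ 3 := Nat.mul_le_mul_right _
          ((by omega : 2 ≤ e).trans (Nat.le_self_pow (by norm_num) e))
      _ = e ^ 6 := by ring

/-! ### The upper bound. -/

/-- Polarisation: a product is a combination of powers of subset sums. -/
theorem factorial_mul_prod_eq_sum {R : Type*} [CommRing R] {d : ℕ} (x : Fin d → R) :
    ∑ S : Fin d → Bool, (∏ j, if S j then 1 else -1) * (∑ j, if S j then x j else 0) ^ d =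
      (d.factorial : R) * ∏ j, x j := by
  have h1 : ∀ S : Fin d → Bool,
      (∏ j, if S j then (1 : R) else -1) * (∑ j, if S j then x j else 0) ^ d =
      ∑ g : Fin d → Fin d, (∏ k, x (g k)) *
        ∏ j, (if S j then (1 : R) else -1) * (if S j ∨ ∀ k, g k ≠ j then 1 else 0) := by
    intro S
    rw [Fintype.sum_pow, Finset.mul_sum]
    refine Finset.sum_congr rfl fun g _ => ?_
    rw [Finset.prod_mul_distrib]
    have : ∏ k, (if S (g k) then x (g k) else 0) =
        (∏ k, x (g k)) * ∏ j, (if S j ∨ ∀ k, g k ≠ j then (1 : R) else 0) := by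
      by_cases hS : ∀ k, S (g k)
      · rw [Finset.prod_congr rfl fun k _ => if_pos (hS k), Finset.prod_eq_one (s := Finset.univ)
          (f := fun j => if S j ∨ ∀ k, g k ≠ j then (1 : R) else 0), mul_one]
        intro j _
        refine if_pos ?_
        by_cases hj : ∃ k, g k = j
        · obtain ⟨k, rfl⟩ := hj
          exact Or.inl (hS k)
        · exact Or.inr (by simpa using hj)
      · push Not at hS
        obtain ⟨k, hk⟩ := hS
        rw [Finset.prod_eq_zero (Finset.mem_univ k) (if_neg hk),
          Finset.prod_eq_zero (f := fun j => if S j ∨ ∀ k, g k ≠ j then (1 : R) else 0)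
            (Finset.mem_univ (g k)) (if_neg ?_), mul_zero]
        rintro (h | h)
        · exact hk h
        · exact h k rfl
    rw [this]
    ring
  -- The signed sum factorises over `j`; an index missed by `g` contributes `1 - 1 = 0`, so only
  -- bijections survive.
  have h2 : ∀ g : Fin d → Fin d, ∑ S : Fin d → Bool,
      ∏ j, (if S j then (1 : R) else -1) * (if S j ∨ ∀ k, g k ≠ j then 1 else 0) =
      if Function.Bijective g then 1 else 0 := by
    intro g
    have := Finset.prod_univ_sum (fun _ : Fin d => (Finset.univ : Finset Bool))
      (fun j b => (if b then (1 : R) else -1) * (if b ∨ ∀ k, g k ≠ j then 1 else 0))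
    rw [Fintype.piFinset_univ] at this
    rw [← this]
    simp only [Fintype.sum_bool, true_or, if_true, one_mul, Bool.false_eq_true, false_or, if_false]
    split_ifs with hg
    · refine Finset.prod_eq_one fun j _ => ?_
      obtain ⟨k, hk⟩ := hg.2 j
      rw [if_neg (by simpa using ⟨k, hk⟩), mul_zero, add_zero]
    · have : ¬ Function.Surjective g := fun h => hg (Finite.injective_iff_bijective.1
        (Finite.injective_iff_surjective.2 h))
      simp only [Function.Surjective, not_forall, not_exists] at this
      obtain ⟨j, hj⟩ := this
      exact Finset.prod_eq_zero (Finset.mem_univ j) (by rw [if_pos hj]; ring)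
  simp_rw [h1]
  rw [Finset.sum_comm]
  simp_rw [← Finset.mul_sum, h2, mul_ite, mul_one, mul_zero]
  rw [← Finset.sum_filter]
  have h3 : ∀ g ∈ Finset.univ.filter (fun g : Fin d → Fin d => Function.Bijective g),
      ∏ k, x (g k) = ∏ j, x j := fun g hg =>
    Function.Bijective.prod_comp (Finset.mem_filter.1 hg).2 x
  rw [Finset.sum_congr rfl h3, Finset.sum_const, nsmul_eq_mul]
  congr 2
  have : (Finset.univ.filter (fun g : Fin d → Fin d => Function.Bijective g)).card =
      Fintype.card (Equiv.Perm (Fin d)) := by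
    rw [← Fintype.card_subtype]
    exact Fintype.card_congr Equiv.bijectiveEquiv
  rw [this, Fintype.card_perm, Fintype.card_fin]

/-- `1 - x ^ d` is a product of `d` affine factors in any `ℂ`-algebra. -/
theorem exists_one_sub_pow_eq_prod {d : ℕ} (hd : d ≠ 0) : ∃ ζ : Fin d → ℂ,
    ∀ {R : Type} [CommRing R] [Algebra ℂ R] (x : R),
      1 - x ^ d = ∏ j, (1 - algebraMap ℂ R (ζ j) * x) := by
  have hprim := Complex.isPrimitiveRoot_exp d hd
  let ε : Fin d ≃ Polynomial.nthRootsFinset d (1 : ℂ) :=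
    (finCongr hprim.card_nthRootsFinset.symm).trans (Finset.equivFin _).symm
  refine ⟨fun j => ε j, fun {R} _ _ x => ?_⟩
  have hpoly : (1 - Polynomial.X ^ d : Polynomial ℂ) =
      ∏ j, (1 - Polynomial.C (ε j : ℂ) * Polynomial.X) := by
    refine Polynomial.funext fun y => ?_
    have := hprim.pow_sub_pow_eq_prod_sub_mul 1 y (Nat.pos_of_ne_zero hd)
    rw [one_pow] at this
    simp only [Polynomial.eval_sub, Polynomial.eval_one, Polynomial.eval_pow, Polynomial.eval_X,
      Polynomial.eval_prod, Polynomial.eval_mul, Polynomial.eval_C]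
    rw [this, ← Finset.prod_coe_sort]
    exact (Equiv.prod_comp ε (fun z => 1 - (z : ℂ) * y)).symm
  simpa using congrArg (Polynomial.aeval x) hpoly

open scoped MvPowerSeries.WithPiTopology in
/-- `δ⁻¹ (∏ (1 + δ Q_i) - 1)` converges to `∑ Q_i` as `δ → 0`. -/
theorem tendsto_coeffVec_prod_one_add {α σ κ : Type*} {l : Filter α} {δ : α → ℂ} (hδ : ∀ x, δ x ≠ 0)
    (hl : Tendsto δ l (𝓝 0)) (s : Finset κ) (Q : κ → MvPolynomial σ ℂ) :
    Tendsto (fun x => coeffVec (C (δ x)⁻¹ * (∏ i ∈ s, (1 + C (δ x) * Q i) - 1))) l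
      (𝓝 (coeffVec (∑ i ∈ s, Q i))) := by
  classical
  -- Coefficientwise convergence is the product topology on power series, where multiplication is
  -- continuous.
  let ψ : MvPolynomial σ ℂ → MvPowerSeries σ ℂ := fun p => p
  have hC : Tendsto (fun x => ψ (C (δ x))) l (𝓝 0) := by
    have h := ((MvPowerSeries.WithPiTopology.continuous_C (σ := σ) (R := ℂ)).tendsto 0).comp hl
    rw [map_zero] at h
    refine h.congr fun x => ?_
    simp [ψ, coe_C]
  change Tendsto (fun x => ψ (C (δ x)⁻¹ * (∏ i ∈ s, (1 + C (δ x) * Q i) - 1))) l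
      (𝓝 (ψ (∑ i ∈ s, Q i)))
  induction s using Finset.induction_on with
  | empty => simpa [ψ] using tendsto_const_nhds
  | insert a s ha ih =>
    have hP : Tendsto (fun x => ψ (∏ i ∈ s, (1 + C (δ x) * Q i))) l (𝓝 1) := by
      have := (hC.mul ih).const_add 1
      rw [zero_mul, add_zero] at this
      refine this.congr fun x => ?_
      have hx : ∏ i ∈ s, (1 + C (δ x) * Q i) =
          1 + C (δ x) * (C (δ x)⁻¹ * (∏ i ∈ s, (1 + C (δ x) * Q i) - 1)) := by
        rw [← mul_assoc, ← C_mul, mul_inv_cancel₀ (hδ x), C_1, one_mul]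
        ring
      conv_rhs => rw [hx]
      simp [ψ]
    have h := (hP.mul_const (ψ (Q a))).add ih
    rw [one_mul] at h
    rw [Finset.sum_insert ha]
    have e1 : ψ (Q a + ∑ i ∈ s, Q i) = ψ (Q a) + ψ (∑ i ∈ s, Q i) := by simp [ψ]
    rw [e1]
    refine h.congr fun x => ?_
    have hx : C (δ x)⁻¹ * (∏ i ∈ insert a s, (1 + C (δ x) * Q i) - 1) =
        (∏ i ∈ s, (1 + C (δ x) * Q i)) * Q a +
          C (δ x)⁻¹ * (∏ i ∈ s, (1 + C (δ x) * Q i) - 1) := by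
      have : (C (δ x)⁻¹ : MvPolynomial σ ℂ) * C (δ x) = 1 := by
        rw [← C_mul, inv_mul_cancel₀ (hδ x), C_1]
      rw [Finset.prod_insert ha]
      linear_combination ((∏ i ∈ s, (1 + C (δ x) * Q i)) * Q a) * this
    rw [hx]
    simp [ψ]

/-- A sum of `d`-th powers of linear forms is a limit of products of affine forms plus constants. -/
theorem affDegeneration_sum_pow {σ κ : Type} [Fintype σ] [Fintype κ] {d e : ℕ} (hd : d ≠ 0)
    (he : e ≠ 0) (hde : Fintype.card κ * d = e) (L : κ → σ → ℂ) :
    AffDegeneration (∑ i, (∑ j, C (L i j) * X j) ^ d : MvPolynomial σ ℂ) (sumProdPow 1 1 e) := by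
  obtain ⟨ζ, hζ⟩ := exists_one_sub_pow_eq_prod hd
  let δ : ℕ → ℂ := fun n => ((n : ℂ) + 1)⁻¹
  have hδ : ∀ n, δ n ≠ 0 := fun n => inv_ne_zero (by exact_mod_cast Nat.succ_ne_zero n)
  have hδ0 : Tendsto δ atTop (𝓝 0) := by
    simpa [δ] using tendsto_one_div_add_atTop_nhds_zero_nat (𝕜 := ℂ)
  refine mem_closure_of_tendsto (tendsto_coeffVec_prod_one_add hδ hδ0 Finset.univ
    fun i => (∑ j, C (L i j) * X j : MvPolynomial σ ℂ) ^ d) (Eventually.of_forall fun n => ?_)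
  refine ⟨_, ?_, rfl⟩
  -- `η` turns `1 + δ L^d` into `1 - (η L)^d`, `ρ` spreads the prefactor `δ⁻¹` over the `e` factors,
  -- and `β` makes the power summand the constant `-δ⁻¹`.
  obtain ⟨η, hη⟩ := IsAlgClosed.exists_pow_nat_eq (-δ n) (Nat.pos_of_ne_zero hd)
  obtain ⟨ρ, hρ⟩ := IsAlgClosed.exists_pow_nat_eq (δ n)⁻¹ (Nat.pos_of_ne_zero he)
  obtain ⟨β, hβ⟩ := IsAlgClosed.exists_pow_nat_eq (-(δ n)⁻¹) (Nat.pos_of_ne_zero he)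
  let E : Fin e ≃ κ × Fin d := Fintype.equivOfCardEq (by simp [hde])
  refine ⟨Matrix.of (Sum.elim (fun k j => -(ρ * (ζ (E k.2).2 * (η * L (E k.2).1 j)))) fun _ _ => 0),
    Sum.elim (fun _ => ρ) fun _ => β, ?_⟩
  have hfac : ∀ k : Fin e, (∑ j, C (-(ρ * (ζ (E k).2 * (η * L (E k).1 j)))) * X j + C ρ :
      MvPolynomial σ ℂ) =
      C ρ * (1 - algebraMap ℂ _ (ζ (E k).2) * (C η * ∑ j, C (L (E k).1 j) * X j)) := by
    intro k
    simp only [C_neg, C_mul, algebraMap_eq, neg_mul, Finset.sum_neg_distrib, mul_assoc,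
      ← Finset.mul_sum]
    ring
  have hprod : ∀ i : κ, ∏ j, (1 - algebraMap ℂ (MvPolynomial σ ℂ) (ζ j) *
      (C η * ∑ j, C (L i j) * X j)) = 1 + C (δ n) * (∑ j, C (L i j) * X j) ^ d := by
    intro i
    rw [← hζ, mul_pow, ← C_pow, hη, C_neg]
    ring
  simp only [affineSubst, sumProdPow, map_add, map_prod, map_pow, aeval_X,
    Finset.univ_unique, Finset.sum_singleton, Matrix.of_apply, Sum.elim_inl, Sum.elim_inr, hfac,
    C_0, zero_mul, Finset.sum_const_zero, zero_add]
  rw [Finset.prod_mul_distrib, Finset.prod_const, Finset.card_univ, Fintype.card_fin, ← C_pow, hρ,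
    ← C_pow, hβ, E.prod_comp (fun q => 1 - algebraMap ℂ (MvPolynomial σ ℂ) (ζ q.2) *
      (C η * ∑ j, C (L q.1 j) * X j)), Fintype.prod_prod_type, Finset.prod_congr rfl
      fun i _ => hprod i, C_neg]
  ring

theorem exists_sumProdPow_eq_sum_pow {d : ℕ} (hd : d ≠ 0) :
    ∃ L : (Fin d → Bool) ⊕ Fin 2 → (Fin 1 × Fin d) ⊕ Fin 2 → ℂ,
      sumProdPow 1 2 d = ∑ i, (∑ j, C (L i j) * X j) ^ d := by
  choose γ hγ using fun S : Fin d → Bool => IsAlgClosed.exists_pow_nat_eq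
    (((d.factorial : ℂ))⁻¹ * ∏ j, if S j then 1 else -1) (Nat.pos_of_ne_zero hd)
  refine ⟨Sum.elim (fun S => Sum.elim (fun k => if S k.2 then γ S else 0) fun _ => 0)
    fun i => Pi.single (Sum.inr i) 1, ?_⟩
  have h1 : ∀ S : Fin d → Bool, (∑ j : Fin d, C (if S j then γ S else 0) *
      X (Sum.inl (0, j)) : MvPolynomial ((Fin 1 × Fin d) ⊕ Fin 2) ℂ) ^ d =
      C (d.factorial : ℂ)⁻¹ * ((∏ j, if S j then 1 else -1) *
        (∑ j, if S j then X (Sum.inl (0, j)) else 0) ^ d) := by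
    intro S
    have : (∑ j : Fin d, C (if S j then γ S else 0) *
      X (Sum.inl (0, j)) : MvPolynomial ((Fin 1 × Fin d) ⊕ Fin 2) ℂ) =
        C (γ S) * ∑ j, if S j then X (Sum.inl (0, j)) else 0 := by
      rw [Finset.mul_sum]
      refine Finset.sum_congr rfl fun j _ => ?_
      split_ifs <;> simp
    rw [this, mul_pow, ← C_pow, hγ, C_mul, map_prod, mul_assoc]
    congr 3
    funext j
    split_ifs <;> simp
  have hfac : (C (d.factorial : ℂ)⁻¹ : MvPolynomial ((Fin 1 × Fin d) ⊕ Fin 2) ℂ) *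
      (d.factorial : MvPolynomial ((Fin 1 × Fin d) ⊕ Fin 2) ℂ) = 1 := by
    rw [← map_natCast (C : ℂ →+* MvPolynomial ((Fin 1 × Fin d) ⊕ Fin 2) ℂ), ← C_mul,
      inv_mul_cancel₀ (by exact_mod_cast d.factorial_ne_zero), C_1]
  have h2 : (∏ j, X (Sum.inl (0, j)) : MvPolynomial ((Fin 1 × Fin d) ⊕ Fin 2) ℂ) =
      ∑ S : Fin d → Bool, C (d.factorial : ℂ)⁻¹ * ((∏ j, if S j then 1 else -1) *
        (∑ j, if S j then X (Sum.inl (0, j)) else 0) ^ d) := by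
    rw [← Finset.mul_sum, factorial_mul_prod_eq_sum, ← mul_assoc, hfac, one_mul]
  rw [sumProdPow, Fintype.sum_sum_type]
  simp only [Finset.univ_unique, Finset.sum_singleton, Fintype.sum_sum_type, Sum.elim_inl,
    Sum.elim_inr, Fintype.sum_prod_type, C_0, zero_mul, Finset.sum_const_zero, add_zero]
  congr 1
  · exact h2.trans (Finset.sum_congr rfl fun S _ => (h1 S).symm)
  · refine Finset.sum_congr rfl fun i _ => ?_
    simp [Pi.single_apply]

theorem natCast_two_pow_mul_le_exp {d : ℕ} (hd : 1 ≤ d) :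
    (((2 ^ d + 2) * d : ℕ) : ℝ) ≤ Real.exp (3 * d) := by
  have h1 : (2 ^ d + 2) * d ≤ 8 ^ d := by
    have h2 : 2 ≤ 2 ^ d := Nat.le_self_pow (by omega) 2
    calc (2 ^ d + 2) * d ≤ (2 ^ d * 2 ^ d) * 2 ^ d :=
          Nat.mul_le_mul (by nlinarith) Nat.lt_two_pow_self.le
      _ = 8 ^ d := by rw [← mul_pow, ← mul_pow]; norm_num
  have h3 : (8 : ℝ) ≤ Real.exp 3 := by
    have : (2 : ℝ) ≤ Real.exp 1 := by linarith [Real.add_one_le_exp (1 : ℝ)]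
    calc (8 : ℝ) = 2 ^ 3 := by norm_num
      _ ≤ Real.exp 1 ^ 3 := pow_le_pow_left₀ (by norm_num) this 3
      _ = Real.exp 3 := by rw [← Real.exp_nat_mul]; norm_num
  calc (((2 ^ d + 2) * d : ℕ) : ℝ) ≤ (8 : ℝ) ^ d := by exact_mod_cast h1
    _ ≤ Real.exp 3 ^ d := pow_le_pow_left₀ (by norm_num) h3 d
    _ = Real.exp (3 * d) := by rw [← Real.exp_nat_mul, mul_comm]

theorem mainTheorem10 :
    (∃ c : ℝ, 0 < c ∧ ∀ d e : ℕ, 2 ≤ d →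
      AffDegeneration (sumProdPow 1 2 d) (sumProdPow 1 1 e) → Real.exp (c * d) ≤ (e : ℝ)) ∧
    (∃ K : ℝ, 0 < K ∧ ∀ d : ℕ, 1 ≤ d → ∃ e : ℕ, (e : ℝ) ≤ Real.exp (K * d) ∧
      AffDegeneration (sumProdPow 1 2 d) (sumProdPow 1 1 e)) := by
  -- `log 2 / 6` comes from `2^d ≤ e^6`; `(2^d + 2) * d` counts `d` factors for each power.
  refine ⟨⟨Real.log 2 / 6, by have := Real.log_pos one_lt_two; positivity, fun d e hd h => ?_⟩,
    ⟨3, by norm_num, fun d hd => ⟨(2 ^ d + 2) * d, natCast_two_pow_mul_le_exp hd, ?_⟩⟩⟩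
  · have h1 : ((2 : ℝ) ^ d) ≤ (e : ℝ) ^ 6 := by exact_mod_cast h.two_pow_le hd
    refine le_of_pow_le_pow_left₀ (n := 6) (by norm_num) (by positivity) ?_
    calc Real.exp (Real.log 2 / 6 * d) ^ 6 = Real.exp (d * Real.log 2) := by
          rw [← Real.exp_nat_mul]
          congr 1
          push_cast
          ring
      _ = 2 ^ d := by rw [Real.exp_nat_mul, Real.exp_log (by norm_num)]
      _ ≤ (e : ℝ) ^ 6 := h1
  · obtain ⟨L, hL⟩ := exists_sumProdPow_eq_sum_pow (d := d) (by omega)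
    rw [hL]
    refine affDegeneration_sum_pow (by omega) (Nat.mul_ne_zero (Nat.succ_ne_zero _) (by omega)) ?_ L
    simp
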